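/- For a simple graph $G$ with $n$ vertices let $\mu_1\ge\mu_2\ge\dots\ge\mu_n=0$ be the eigenvalues of its Laplacian matrix $L(G)=D(G)-A(G)$, and let $LEL(G)=\sum_{k=1}^{n-1}\sqrt{\mu_k}$ be its Laplacian-like energy. A unicyclic graph is a connected graph with as many edges as vertices; a leaf is a vertex of degree one. For $g\ge 3$ and $l\ge 1$, $p\ge 0$ with $g+p+l\le n$, let $U_{n,l}^{g,p}$ be the $n$-vertex graph obtained from a cycle of length $g$ by identifying one end of a path with $p$ edges with a vertex of the cycle, and attaching at the other end of this path (at the cycle vertex itself if $p=0$) $l$ pendent paths, each of length $\lfloor\frac{n-g-p}{l}\rfloor$ or $\lceil\frac{n-g-p}{l}\rceil$, with total length $n-g-p$. For $l=0$ let $U_{g,0}^{g,0}$ be the cycle of length $g$. Let $G$ be a unicyclic graph with $n$ vertices and exactly $l$ leaves. (1) If $G$ has girth $3$, then for $p=\max\{0,\lfloor\frac{n-3-2l}{l+1}\rfloor\}$, $$LEL(G)\ \ge\ \min\{LEL(U_{n,l}^{3,0}),LEL(U_{n,l}^{3,1}),\dots,LEL(U_{n,l}^{3,p})\}.$$ (2)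 If $G$ has girth $4$, then for $p=\max\{0,\lfloor\frac{n-4-3l}{l+1}\rfloor\}$, $$LEL(G)\ \ge\ \min\{LEL(U_{n,l}^{4,0}),LEL(U_{n,l}^{4,1}),\dots,LEL(U_{n,l}^{4,p})\}.$$ -/

import Mathlib

/-- A unicyclic graph: a connected graph with as many edges as vertices. -/
def IsUnicyclic {V : Type*} [Fintype V] (G : SimpleGraph V) : Prop :=
  G.Connected ∧ G.edgeSet.ncard = Fintype.card V

open Classical in
/-- The number of leaves (vertices of degree one) of `G`. -/
noncomputable def numLeaves {V : Type*} [Fintype V] (G : SimpleGraph V) : ℕ :=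
  (Finset.univ.filter fun v : V => G.degree v = 1).card

open Classical in
/-- The Laplacian matrix `D(G) - A(G)` is Hermitian. -/
theorem lapMatrix_isHermitian {V : Type*} [Fintype V] (G : SimpleGraph V) :
    (G.lapMatrix ℝ).IsHermitian :=
  (SimpleGraph.posSemidef_lapMatrix ℝ G).isHermitian

open Classical in
/-- The Laplacian-like energy: the sum of the square roots of the eigenvalues (with multiplicity)
`μ₁ ≥ ⋯ ≥ μₙ` of the Laplacian matrix. The smallest eigenvalue is `μₙ = 0`, so that summing over
all of them or over `μ₁, …, μₙ₋₁` only is the same. -/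
noncomputable def LEL {V : Type*} [Fintype V] (G : SimpleGraph V) : ℝ :=
  ∑ k : V, Real.sqrt ((lapMatrix_isHermitian G).eigenvalues k)

/-- The earlier neighbour of the vertex `v` in the balanced starlike unicyclic graph:
* `0, …, g - 1` is the path `0 - 1 - ⋯ - (g - 1)`, to be closed up to a cycle of length `g`;
* `g, …, g + p - 1` continue the path of length `p` that starts at the cycle vertex `0`; its other
  end is the centre (the centre is the cycle vertex `0` if `p = 0`);
* the next `l` vertices are joined to the centre, and each further vertex `v` is joined to `v - l`.
  So the vertices from `g + p` on are dealt out in turn to `l` pendent paths at the centre, whose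
  lengths differ by at most one. -/
def starlikeParent (g l p v : ℕ) : ℕ :=
  if v < g then v - 1
  else if v < g + p then (if v = g then 0 else v - 1)
  else if v < g + p + l then (if p = 0 then 0 else g + p - 1)
  else v - l

/-- The balanced starlike unicyclic graph `U_{n,l}^{g,p}` of order `n` with `l` leaves and girth
`g` (for `3 ≤ g`, `1 ≤ l` and `g + p + l ≤ n`, and also the cycle of length `g` for `n = g`,
`l = 0`, `p = 0`): one end of a path of length `p` is identified with a vertex of the cycle of
length `g`, and its other end with the centre of the balanced starlike tree of order
`n - p - g + 1` with `l` leaves. -/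
def balancedUnicyclic (n l g p : ℕ) : SimpleGraph (Fin n) :=
  SimpleGraph.fromRel fun a b : Fin n =>
    (a : ℕ) = starlikeParent g l p b ∨ ((a : ℕ) = 0 ∧ (b : ℕ) = g - 1)

/-! The difference of two Laplacian-like energies on the same number of vertices is, up to the
factor π, the integral over s > 0 of the difference of log det(s² + L). So it is enough to find one
competitor whose determinant det(t + L) is at most that of G for every t > 0
(`LEL_le_LEL_of_lapDet_le`); the competitor must not depend on t.

Read t + L as an electrical network. A rooted piece enters the determinant only through a dual
number: the determinant with the root deleted, and that determinant times the conductance ("load")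
the piece puts on its root. Gluing roots multiplies dual numbers, since loads add; a new edge at the
root acts by `plant`. Eliminating pendant vertices (`lapDet_pendant`) turns G into its cycle with
rooted trees at the cycle vertices.

The determinant is then lowered without changing order, girth or number of leaves. On a triangle or
quadrilateral all trees may be moved to one vertex. Moving branches along a path towards its heavier
end lowers determinants (`LoadLE.detLE_mul_iterate_plant`, `LoadLE.detLE_mul_mul_iterate_plant`).
Applied at shortest legs, this turns the tree into a starlike tree at the end of a path
(`GraftTree.exists_detLE`); applied to single edges, it shortens that path to the stated bound
(`exists_total_le`) and balances the legs (`detLE_legsVal_of_balanced`). -/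

/-! ### Square roots as integrals of logarithms. -/

open Filter Topology in
theorem tendsto_mul_log_one_add_sq_div (a : ℝ) :
    Tendsto (fun s : ℝ => s * Real.log (1 + a ^ 2 / s ^ 2)) atTop (𝓝 0) := by
  have hlim : Tendsto (fun s : ℝ => a ^ 2 / s) atTop (𝓝 0) :=
    tendsto_const_nhds.div_atTop tendsto_id
  refine squeeze_zero' ?_ ?_ hlim
  · filter_upwards [eventually_gt_atTop 0] with s hs
    exact mul_nonneg hs.le (Real.log_nonneg (by have : 0 ≤ a ^ 2 / s ^ 2 := by positivity
                                                linarith))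
  · filter_upwards [eventually_gt_atTop 0] with s hs
    have h : Real.log (1 + a ^ 2 / s ^ 2) ≤ a ^ 2 / s ^ 2 := by
      have := Real.log_le_sub_one_of_pos (x := 1 + a ^ 2 / s ^ 2) (by positivity)
      linarith
    calc s * Real.log (1 + a ^ 2 / s ^ 2) ≤ s * (a ^ 2 / s ^ 2) := by gcongr
      _ = a ^ 2 / s := by field_simp

/-- An antiderivative of `s ↦ log (s ^ 2 + a ^ 2) + 2` that vanishes at `0`. -/
noncomputable def logSqPrimitive (a s : ℝ) : ℝ :=
  s * Real.log (s ^ 2 + a ^ 2) + 2 * a * Real.arctan (s / a)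

theorem continuous_logSqPrimitive (a : ℝ) : Continuous (logSqPrimitive a) := by
  unfold logSqPrimitive
  refine Continuous.add ?_ (by fun_prop)
  -- For a = 0 the logarithm is singular at s = 0, but s log s extends continuously.
  rcases eq_or_ne a 0 with rfl | ha
  · have : (fun s : ℝ => s * Real.log (s ^ 2 + 0 ^ 2)) = fun s => 2 * (s * Real.log s) := by
      ext s
      simp [Real.log_pow]
      ring
    rw [this]
    exact continuous_const.mul Real.continuous_mul_log
  · refine continuous_id.mul (Continuous.log (by fun_prop) fun s => ?_)
    positivity

theorem hasDerivAt_logSqPrimitive (a : ℝ) {s : ℝ} (hs : 0 < s) :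
    HasDerivAt (logSqPrimitive a) (Real.log (s ^ 2 + a ^ 2) + 2) s := by
  have hp : s ^ 2 + a ^ 2 ≠ 0 := by positivity
  have h1 : HasDerivAt (fun s : ℝ => s ^ 2 + a ^ 2) (2 * s) s := by
    simpa using (hasDerivAt_pow 2 s).add_const (a ^ 2)
  have h2 := (hasDerivAt_id s).mul (h1.log hp)
  have h3 := (((hasDerivAt_id s).div_const a).arctan).const_mul (2 * a)
  have h4 := h2.add h3
  refine h4.congr_deriv ?_
  rcases eq_or_ne a 0 with rfl | ha
  · simp
    field_simp
  · have : 1 + (s / a) ^ 2 ≠ 0 := by positivity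
    simp only [id]
    field_simp
    ring

open Filter Topology in
-- The difference equals s log(1 + a²/s²) + 2a arctan(s/a): the first term vanishes in the limit,
-- the second tends to 2a · π/2.
theorem tendsto_logSqPrimitive_sub {a : ℝ} (ha : 0 ≤ a) :
    Tendsto (fun s => logSqPrimitive a s - s * Real.log (s ^ 2)) atTop (𝓝 (Real.pi * a)) := by
  have h2 : Tendsto (fun s : ℝ => 2 * a * Real.arctan (s / a)) atTop (𝓝 (Real.pi * a)) := by
    rcases ha.eq_or_lt with rfl | ha
    · simp
    · have h := (Real.tendsto_arctan_atTop.mono_right nhdsWithin_le_nhds).comp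
        (tendsto_id.atTop_div_const ha)
      have h' := h.const_mul (2 * a)
      have e : 2 * a * (Real.pi / 2) = Real.pi * a := by ring
      rw [e] at h'
      exact h'
  have h := (tendsto_mul_log_one_add_sq_div a).add h2
  rw [zero_add] at h
  refine h.congr' ?_
  filter_upwards [eventually_gt_atTop 0] with s hs
  have : 1 + a ^ 2 / s ^ 2 = (s ^ 2 + a ^ 2) / s ^ 2 := by field_simp
  rw [this, Real.log_div (by positivity) (by positivity)]
  unfold logSqPrimitive
  ring

open Filter Topology in
/-- If `∏ (t + μ i) ≤ ∏ (t + ν i)` for all `t > 0`, then `∑ √(μ i) ≤ ∑ √(ν i)`. -/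
theorem sum_sqrt_le_sum_sqrt_of_prod_add_le {ι κ : Type*} [Fintype ι] [Fintype κ]
    (hcard : Fintype.card ι = Fintype.card κ) {μ : ι → ℝ} {ν : κ → ℝ} (hμ : ∀ i, 0 ≤ μ i)
    (hν : ∀ i, 0 ≤ ν i) (h : ∀ t : ℝ, 0 < t → ∏ i, (t + μ i) ≤ ∏ i, (t + ν i)) :
    ∑ i, √(μ i) ≤ ∑ i, √(ν i) := by
  set D : ℝ → ℝ := fun s =>
    ∑ i, logSqPrimitive √(ν i) s - ∑ i, logSqPrimitive √(μ i) s with hD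
  have hcont : Continuous D :=
    (continuous_finsetSum _ fun i _ => continuous_logSqPrimitive _).sub
      (continuous_finsetSum _ fun i _ => continuous_logSqPrimitive _)
  have hderiv : ∀ s : ℝ, 0 < s → HasDerivAt D
      (∑ i, (Real.log (s ^ 2 + √(ν i) ^ 2) + 2) - ∑ i, (Real.log (s ^ 2 + √(μ i) ^ 2) + 2)) s :=
    fun s hs => (HasDerivAt.fun_sum fun i _ => hasDerivAt_logSqPrimitive _ hs).sub
      (HasDerivAt.fun_sum fun i _ => hasDerivAt_logSqPrimitive _ hs)
  have hmono : MonotoneOn D (Set.Ici 0) := by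
    refine monotoneOn_of_hasDerivWithinAt_nonneg (convex_Ici 0) hcont.continuousOn
      (fun s hs => (hderiv s (by simpa using hs)).hasDerivWithinAt) fun s hs => ?_
    have hs : 0 < s := by simpa using hs
    have e1 : ∑ i, Real.log (s ^ 2 + √(ν i) ^ 2) = Real.log (∏ i, (s ^ 2 + ν i)) := by
      rw [Real.log_prod fun i _ => (by have := hν i; positivity)]
      exact Finset.sum_congr rfl fun i _ => by rw [Real.sq_sqrt (hν i)]
    have e2 : ∑ i, Real.log (s ^ 2 + √(μ i) ^ 2) = Real.log (∏ i, (s ^ 2 + μ i)) := by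
      rw [Real.log_prod fun i _ => (by have := hμ i; positivity)]
      exact Finset.sum_congr rfl fun i _ => by rw [Real.sq_sqrt (hμ i)]
    have hlog : Real.log (∏ i, (s ^ 2 + μ i)) ≤ Real.log (∏ i, (s ^ 2 + ν i)) :=
      Real.log_le_log (Finset.prod_pos fun i _ => by have := hμ i; positivity)
        (h _ (by positivity))
    rw [Finset.sum_add_distrib, Finset.sum_add_distrib, e1, e2]
    simp only [Finset.sum_const, Finset.card_univ, hcard]
    linarith
  -- `D` increases from 0 to its limit at infinity. The divergent terms s log s² cancel there
  -- because both families have the same size.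
  have hzero : D 0 = 0 := by simp [hD, logSqPrimitive]
  have hlim : Tendsto D atTop
      (𝓝 (∑ i, Real.pi * √(ν i) - ∑ i, Real.pi * √(μ i))) := by
    refine ((tendsto_finsetSum _ fun i _ =>
      tendsto_logSqPrimitive_sub (Real.sqrt_nonneg (ν i))).sub (tendsto_finsetSum _ fun i _ =>
      tendsto_logSqPrimitive_sub (Real.sqrt_nonneg (μ i)))).congr fun s => ?_
    simp only [hD, Finset.sum_sub_distrib, Finset.sum_const, Finset.card_univ, hcard]
    ring
  have hge : 0 ≤ ∑ i, Real.pi * √(ν i) - ∑ i, Real.pi * √(μ i) := by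
    refine ge_of_tendsto hlim ?_
    filter_upwards [eventually_ge_atTop 0] with s hs
    rw [← hzero]
    exact hmono (by simp) (by simpa using hs) hs
  rw [← Finset.mul_sum, ← Finset.mul_sum, ← mul_sub] at hge
  have := nonneg_of_mul_nonneg_right hge Real.pi_pos
  linarith

/-! ### Loaded Laplacian determinants and elimination of pendant vertices. -/

open Classical in
/-- The matrix `t + L(G)`, with rows scaled and with loads: `x v` has the scaling factor of the row
of `v` as its first component and the (scaled) load at `v` as its second one. -/
noncomputable def loadedLap {V : Type*} [Fintype V] (t : ℝ) (G : SimpleGraph V)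
    (x : V → DualNumber ℝ) : Matrix V V ℝ := fun i j =>
  if i = j then (x i).snd + t * (x i).fst + (x i).fst * G.degree i
  else if G.Adj i j then -(x i).fst else 0

open Classical in
/-- The determinant of the loaded Laplacian matrix. -/
noncomputable def lapDet {V : Type*} [Fintype V] (t : ℝ) (G : SimpleGraph V)
    (x : V → DualNumber ℝ) : ℝ := (loadedLap t G x).det

open Classical in
theorem lapDet_one {V : Type*} [Fintype V] (t : ℝ) (G : SimpleGraph V) :
    lapDet t G 1 = ∏ i, (t + (lapMatrix_isHermitian G).eigenvalues i) := by
  have hm : loadedLap t G 1 = -(Matrix.scalar V (-t) - G.lapMatrix ℝ) := by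
    ext i j
    by_cases hij : i = j
    · subst hij
      simp [loadedLap, SimpleGraph.lapMatrix, SimpleGraph.degMatrix]
      ring
    · simp [loadedLap, SimpleGraph.lapMatrix, SimpleGraph.degMatrix, hij]
      split_ifs <;> simp
  rw [lapDet, hm, Matrix.det_neg, ← Matrix.eval_charpoly, (lapMatrix_isHermitian G).charpoly_eq,
    Polynomial.eval_prod, ← Finset.card_univ, ← Finset.prod_const, ← Finset.prod_mul_distrib]
  exact Finset.prod_congr rfl fun i _ => by simp; ring

open Classical in
theorem LEL_le_LEL_of_lapDet_le {V W : Type*} [Fintype V] [Fintype W] {G : SimpleGraph V}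
    {H : SimpleGraph W} (hcard : Fintype.card V = Fintype.card W)
    (h : ∀ t : ℝ, 0 < t → lapDet t G 1 ≤ lapDet t H 1) : LEL G ≤ LEL H :=
  sum_sqrt_le_sum_sqrt_of_prod_add_le hcard
    (fun i => (SimpleGraph.posSemidef_lapMatrix ℝ G).eigenvalues_nonneg i)
    (fun i => (SimpleGraph.posSemidef_lapMatrix ℝ H).eigenvalues_nonneg i)
    fun t ht => by rw [← lapDet_one, ← lapDet_one]; exact h t ht

/-- The loaded rooted graph obtained from a loaded rooted graph by attaching a new root to its
root. -/
def plant (t : ℝ) (x : DualNumber ℝ) : DualNumber ℝ :=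
  (x.snd + (1 + t) * x.fst, x.snd + t * x.fst)

@[simp]
theorem fst_plant (t : ℝ) (x : DualNumber ℝ) : (plant t x).fst = x.snd + (1 + t) * x.fst := rfl

@[simp]
theorem snd_plant (t : ℝ) (x : DualNumber ℝ) : (plant t x).snd = x.snd + t * x.fst := rfl

theorem dual_snd_mul (x y : DualNumber ℝ) :
    (x * y).snd = x.fst * y.snd + x.snd * y.fst := by
  simp [TrivSqZeroExt.snd_mul, mul_comm]

theorem lapDet_iso {V W : Type*} [Fintype V] [Fintype W] (t : ℝ) {G : SimpleGraph V}
    {H : SimpleGraph W} (e : G ≃g H) (x : W → DualNumber ℝ) :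
    lapDet t G (x ∘ e) = lapDet t H x := by
  classical
  rw [lapDet, lapDet, ← Matrix.det_submatrix_equiv_self e.toEquiv (loadedLap t H x)]
  congr 1
  · ext i j
    have hd : H.degree (e i) = G.degree i := e.degree_eq i
    simp only [loadedLap, Matrix.submatrix_apply, Function.comp_apply]
    change _ = if e i = e j then _ + _ * (H.degree (e i) : ℝ) else if H.Adj (e i) (e j) then _ else _
    simp only [e.injective.eq_iff, e.map_adj_iff]
    congr! 4
    convert hd.symm

section Pendant

variable {V W : Type*} [Fintype V] [Fintype W] {G : SimpleGraph V} {H : SimpleGraph W}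
  (e : Option W ≃ V) {u : W}

theorem degree_some_of_pendant [DecidableEq W] [∀ v, Fintype (G.neighborSet v)]
    [∀ v, Fintype (H.neighborSet v)]
    (hadj : ∀ a b, G.Adj (e (some a)) (e (some b)) ↔ H.Adj a b)
    (hu : ∀ a, G.Adj (e none) (e (some a)) ↔ a = u) (a : W) :
    G.degree (e (some a)) = H.degree a + if a = u then 1 else 0 := by
  classical
  have h := SimpleGraph.degree_eq_sum_if_adj (R := ℕ) G (e (some a))
  rw [← e.sum_comp, Fintype.sum_option] at h
  simp only [hadj, G.adj_comm (e (some a)) (e none), hu] at h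
  have h' := SimpleGraph.degree_eq_sum_if_adj (R := ℕ) H a
  simp only [Nat.cast_id] at h h'
  rw [← h', add_comm] at h
  convert h

theorem degree_none_of_pendant [Fintype (G.neighborSet (e none))]
    (hu : ∀ a, G.Adj (e none) (e (some a)) ↔ a = u) :
    G.degree (e none) = 1 := by
  classical
  have h := SimpleGraph.degree_eq_sum_if_adj (R := ℕ) G (e none)
  rw [← e.sum_comp, Fintype.sum_option] at h
  simp only [G.loopless.irrefl, hu, Nat.cast_id, if_false, Finset.sum_ite_eq',
    Finset.mem_univ, if_true, zero_add] at h
  convert h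

open Classical in
/-- Elimination of the pendant vertex `e none`, whose neighbour is `e (some u)`. -/
theorem lapDet_pendant (hadj : ∀ a b, G.Adj (e (some a)) (e (some b)) ↔ H.Adj a b)
    (hu : ∀ a, G.Adj (e none) (e (some a)) ↔ a = u) (t : ℝ) (x : V → DualNumber ℝ)
    (hx : (plant t (x (e none))).fst ≠ 0) :
    lapDet t G x = lapDet t H (fun w =>
      if w = u then x (e (some w)) * plant t (x (e none)) else x (e (some w))) := by
  set q : ℝ := (plant t (x (e none))).fst with hq
  let f : W ⊕ Unit ≃ V := (Equiv.optionEquivSumPUnit W).symm.trans e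
  obtain ⟨A, hA⟩ : ∃ A : Matrix W W ℝ, ∀ a b, A a b = loadedLap t G x (e (some a)) (e (some b)) :=
    ⟨fun a b => _, fun _ _ => rfl⟩
  obtain ⟨B, hB⟩ : ∃ B : Matrix W Unit ℝ,
      ∀ a b, B a b = if a = u then -(x (e (some u))).fst else 0 :=
    ⟨fun a b => _, fun _ _ => rfl⟩
  obtain ⟨C, hC⟩ : ∃ C : Matrix Unit W ℝ, ∀ a b, C a b = if b = u then -(x (e none)).fst else 0 :=
    ⟨fun a b => _, fun _ _ => rfl⟩
  obtain ⟨D, hD⟩ : ∃ D : Matrix Unit Unit ℝ, D = q • 1 := ⟨_, rfl⟩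
  have hblock : (loadedLap t G x).submatrix f f = Matrix.fromBlocks A B C D := by
    ext i j
    rcases i with a | i <;> rcases j with b | j
    · simp [f, hA]
    · have h : e (some a) ≠ e none := fun h => by simpa using e.injective h
      rw [Matrix.submatrix_apply, Matrix.fromBlocks_apply₁₂, hB]
      simp only [f, loadedLap,
        Equiv.trans_apply, Equiv.optionEquivSumPUnit_symm_inl, Equiv.optionEquivSumPUnit_symm_inr,
        if_neg h, G.adj_comm (e (some a)) (e none), hu]
      split_ifs with h <;> simp [h]
    · have h : e none ≠ e (some b) := fun h => by simpa using e.injective h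
      rw [Matrix.submatrix_apply, Matrix.fromBlocks_apply₂₁, hC]
      simp only [f, loadedLap,
        Equiv.trans_apply, Equiv.optionEquivSumPUnit_symm_inl, Equiv.optionEquivSumPUnit_symm_inr,
        if_neg h, hu]
    · rw [Matrix.submatrix_apply, Matrix.fromBlocks_apply₂₂, hD]
      have hdeg : ∀ [Fintype (G.neighborSet (e none))], G.degree (e none) = 1 :=
        degree_none_of_pendant e hu
      change loadedLap t G x (e none) (e none) = _
      simp [loadedLap, hdeg, hq]
      ring
  have hDdet : D.det = q := by simp [hD]
  let _ : Invertible D := D.invertibleOfIsUnitDet (by rw [hDdet]; exact hx.isUnit)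
  have hDinv : ⅟D = q⁻¹ • (1 : Matrix Unit Unit ℝ) := by
    refine invOf_eq_right_inv ?_
    rw [hD, smul_mul_smul_comm, mul_inv_cancel₀ hx, one_smul, one_mul]
  -- Schur complement with respect to the pendant vertex; it differs from A only in the diagonal
  -- entry at u.
  rw [lapDet, ← Matrix.det_submatrix_equiv_self f, hblock, Matrix.det_fromBlocks₂₂, hDdet, hDinv]
  set S := A - B * q⁻¹ • (1 : Matrix Unit Unit ℝ) * C with hS
  have hSe : ∀ a b, S a b = A a b - q⁻¹ * (B a () * C () b) := by
    intro a b
    simp [hS, Matrix.mul_apply]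
  -- The factor q is absorbed into row u. This is why rows carry scaling factors: no division is
  -- left.
  have hrow : q * S.det = (S.updateRow u (q • S u)).det := by
    rw [Matrix.det_updateRow_smul, Matrix.updateRow_eq_self]
  rw [hrow, lapDet]
  congr 1
  ext a b
  have hdeg : ∀ [Fintype (G.neighborSet (e (some a)))] [Fintype (H.neighborSet a)],
      G.degree (e (some a)) = H.degree a + if a = u then 1 else 0 := by
    intro _ _
    convert degree_some_of_pendant e hadj hu a
  have hinj : e (some a) = e (some b) ↔ a = b := by simp
  by_cases ha : a = u
  · subst ha
    rw [Matrix.updateRow_self]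
    simp only [Pi.smul_apply, smul_eq_mul, hSe, hA, hB, hC, loadedLap, hinj, hadj, if_true, hdeg]
    by_cases hb : a = b
    · subst hb
      have hq' : q = (x (e none)).snd + (1 + t) * (x (e none)).fst := hq
      simp only [if_true, dual_snd_mul, snd_plant, TrivSqZeroExt.fst_mul, ← hq]
      field_simp
      push_cast
      linear_combination (x (e (some a))).fst * hq'
    · simp only [hb, Ne.symm hb, if_false, TrivSqZeroExt.fst_mul, ← hq]
      split_ifs <;> ring
  · rw [Matrix.updateRow_ne ha]
    simp only [hSe, hA, hB, hC, loadedLap, hinj, hadj, if_neg ha, hdeg]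
    by_cases hb : a = b <;> simp [hb]

end Pendant

/-! ### Rooted trees and their dual numbers. -/

/-- Finite rooted trees: a single vertex, or a rooted tree `T` together with another rooted tree `S`
whose root is joined to the root of `T`. -/
inductive GraftTree
  | single : GraftTree
  | graft (T S : GraftTree) : GraftTree

namespace GraftTree

/-- The number of vertices. -/
def order : GraftTree → ℕ
  | single => 1
  | graft T S => T.order + S.order

/-- The number of leaves other than the root. -/
def leaves : GraftTree → ℕ
  | single => 0
  | graft T S => T.leaves + max 1 S.leaves

/-- The loaded rooted graph of a rooted tree: the determinant of `t + L` with the root deleted, and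
this determinant times the load at the root. -/
def val (t : ℝ) : GraftTree → DualNumber ℝ
  | single => 1
  | graft T S => T.val t * plant t (S.val t)

theorem val_pos {t : ℝ} (ht : 0 < t) (T : GraftTree) : 0 < (T.val t).fst ∧ 0 ≤ (T.val t).snd := by
  induction T with
  | single => simp [val]
  | graft T S hT hS =>
    obtain ⟨h1, h2⟩ := hT
    obtain ⟨h3, h4⟩ := hS
    simp only [val, TrivSqZeroExt.fst_mul, dual_snd_mul, fst_plant, snd_plant]
    constructor <;> positivity

end GraftTree

/-! ### Reduction of a unicyclic graph to its decorated cycle. -/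

namespace SimpleGraph

variable {V : Type*}

theorem Connected.surjective_of_forall_adj {ι : Type*} [Nonempty ι] {G : SimpleGraph V}
    (hG : G.Connected) (f : ι → V) (h : ∀ i v, G.Adj (f i) v → v ∈ Set.range f) :
    Function.Surjective f := by
  have key : ∀ a b, G.Walk a b → a ∈ Set.range f → b ∈ Set.range f := by
    intro a b p
    induction p with
    | nil => exact id
    | cons hadj _ ih =>
      rintro ⟨i, rfl⟩
      exact ih (h i _ hadj)
  intro b
  obtain ⟨p⟩ := hG.preconnected (f (Classical.arbitrary ι)) b
  exact key _ _ p ⟨_, rfl⟩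

/-- A connected graph of average degree two without vertices of degree one, that contains a cycle,
is this cycle. -/
theorem Connected.exists_iso_cycleGraph [Fintype V] {G : SimpleGraph V} {m : ℕ}
    [DecidableRel G.Adj] (hG : G.Connected) (hsum : ∑ v, G.degree v = 2 * Fintype.card V)
    (hdeg : ∀ v, G.degree v ≠ 1) (φ : cycleGraph (m + 3) →g G) (hφ : Function.Injective φ) :
    Nonempty (cycleGraph (m + 3) ≃g G) := by
  classical
  have : Nontrivial V := hφ.nontrivial
  have h2 : ∀ v, 2 ≤ G.degree v := fun v => by
    have := hG.preconnected.degree_pos_of_nontrivial v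
    have := hdeg v
    omega
  -- All degrees are at least 2 and their average is 2. The cycle then already contains every
  -- neighbour of its vertices.
  have hdeg2 : ∀ v, G.degree v = 2 := by
    have h : ∑ v : V, 2 = ∑ v, G.degree v := by simp [hsum, mul_comm]
    have := (Finset.sum_eq_sum_iff_of_le fun v _ => h2 v).1 h
    exact fun v => (this v (Finset.mem_univ v)).symm
  have hN : ∀ i, ((cycleGraph (m + 3)).neighborFinset i).image φ = G.neighborFinset (φ i) := by
    intro i
    refine Finset.eq_of_subset_of_card_le ?_ ?_
    · intro v hv
      obtain ⟨j, hj, rfl⟩ := Finset.mem_image.1 hv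
      rw [mem_neighborFinset] at hj ⊢
      exact φ.map_adj hj
    · rw [card_neighborFinset_eq_degree, hdeg2, Finset.card_image_of_injective _ hφ,
        card_neighborFinset_eq_degree, cycleGraph_degree_three_le]
  have hsurj : Function.Surjective φ := hG.surjective_of_forall_adj φ fun i v hv => by
    rw [← mem_neighborFinset, ← hN] at hv
    obtain ⟨j, _, rfl⟩ := Finset.mem_image.1 hv
    exact ⟨j, rfl⟩
  refine ⟨⟨Equiv.ofBijective φ ⟨hφ, hsurj⟩, ?_⟩⟩
  intro i j
  refine ⟨fun h => ?_, fun h => φ.map_adj h⟩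
  have h' : φ j ∈ G.neighborFinset (φ i) := (mem_neighborFinset _ _ _).2 h
  rw [← hN] at h'
  obtain ⟨k, hk, hkj⟩ := Finset.mem_image.1 h'
  rw [← hφ hkj]
  exact (mem_neighborFinset _ _ _).1 hk

open Classical in
/-- Eliminating pendant vertices one after the other reduces a unicyclic graph to its cycle, with
rooted trees at its vertices. -/
theorem Connected.exists_graftTree_decoration {m : ℕ} (k : ℕ) :
    ∀ {V : Type*} [Fintype V] {G : SimpleGraph V} (T : V → GraftTree), Fintype.card V = k →
      G.Connected → ∑ v, G.degree v = 2 * Fintype.card V →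
      ∀ φ : cycleGraph (m + 3) →g G, Function.Injective φ →
      ∃ T' : Fin (m + 3) → GraftTree,
        (∀ t : ℝ, 0 < t → lapDet t G (fun v => (T v).val t) =
          lapDet t (cycleGraph (m + 3)) (fun i => (T' i).val t)) ∧
        ∑ i, (T' i).order = ∑ v, (T v).order ∧
        ∑ i, (T' i).leaves =
          ∑ v, (if G.degree v = 1 then max 1 (T v).leaves else (T v).leaves) := by
  induction k with
  | zero =>
    intro V _ G T hk hG
    have := hG.nonempty
    exact absurd hk Fintype.card_ne_zero
  | succ k ih =>
    intro V _ G T hk hG hsum φ hφ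
    by_cases hleaf : ∃ v, G.degree v = 1
    swap
    · push Not at hleaf
      obtain ⟨f⟩ := hG.exists_iso_cycleGraph hsum hleaf φ hφ
      refine ⟨T ∘ f, fun t _ => (lapDet_iso t f _).symm, ?_, ?_⟩
      · exact f.toEquiv.sum_comp fun v => (T v).order
      · simp only [hleaf, if_false]
        exact f.toEquiv.sum_comp fun v => (T v).leaves
    obtain ⟨v, hv⟩ := hleaf
    obtain ⟨u, huv, hu⟩ := degree_eq_one_iff_existsUnique_adj.1 hv
    obtain ⟨e, he0, he1⟩ : ∃ e : Option {w // w ≠ v} ≃ V, e none = v ∧ ∀ w, e (some w) = w :=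
      ⟨Equiv.optionSubtypeNe v, Equiv.optionSubtypeNe_none v, Equiv.optionSubtypeNe_some v⟩
    obtain ⟨H, hGH⟩ : ∃ H : SimpleGraph {w // w ≠ v}, H = G.comap Subtype.val := ⟨_, rfl⟩
    obtain ⟨u', hu'u⟩ : ∃ u' : {w // w ≠ v}, u' = u := ⟨⟨u, huv.ne'⟩, rfl⟩
    have hadj : ∀ a b, G.Adj (e (some a)) (e (some b)) ↔ H.Adj a b := fun a b => by
      rw [he1, he1, hGH, comap_adj]
    have hu' : ∀ a, G.Adj (e none) (e (some a)) ↔ a = u' := by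
      intro a
      rw [he0, he1, Subtype.ext_iff, hu'u]
      exact ⟨fun h => hu _ h, fun h => h ▸ huv⟩
    have hφv : ∀ i, φ i ≠ v := by
      rintro i rfl
      obtain ⟨a, b, hab, hN⟩ := Finset.card_eq_two.1 (cycleGraph_degree_three_le (v := i))
      have ha : (cycleGraph (m + 3)).Adj i a := by
        rw [← mem_neighborFinset, hN]; simp
      have hb : (cycleGraph (m + 3)).Adj i b := by
        rw [← mem_neighborFinset, hN]; simp
      exact hab (hφ ((hu _ (φ.map_adj ha)).trans (hu _ (φ.map_adj hb)).symm))
    let ψ : cycleGraph (m + 3) →g H := ⟨fun i => ⟨φ i, hφv i⟩, fun h => by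
      rw [hGH]; exact φ.map_adj h⟩
    have hψ : Function.Injective ψ := fun i j h => hφ (congrArg Subtype.val h)
    have hW : Nontrivial {w // w ≠ v} := hψ.nontrivial
    have hH : H.Connected := hGH ▸ hG.induce_compl_singleton_of_degree_eq_one hv
    have hdeg : ∀ a : {w // w ≠ v}, G.degree a = H.degree a + if a = u' then 1 else 0 := fun a => by
      have := degree_some_of_pendant e hadj hu' a
      convert this using 2
      exact (he1 a).symm
    have hsumV : ∀ F : V → ℕ, ∑ v, F v = F v + ∑ w : {w // w ≠ v}, F w := fun F => by
      rw [← e.sum_comp, Fintype.sum_option, he0]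
      simp only [he1]
    have hcard : Fintype.card {w // w ≠ v} = k := by
      have := Fintype.card_congr e
      rw [Fintype.card_option] at this
      omega
    obtain ⟨T₁, hT₁⟩ : ∃ T₁ : {w // w ≠ v} → GraftTree,
        ∀ w, T₁ w = if w = u' then (T w).graft (T v) else T w := ⟨fun w => _, fun _ => rfl⟩
    obtain ⟨T', hdet, hord, hlv⟩ := ih T₁ hcard hH (by
      have h := hsumV fun v => G.degree v
      simp only [hsum, hv, hdeg, Finset.sum_add_distrib, Finset.sum_ite_eq', Finset.mem_univ,
        if_true] at h
      omega) ψ hψ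
    refine ⟨T', fun t ht => ?_, ?_, ?_⟩
    · rw [← hdet t ht, lapDet_pendant e hadj hu']
      · congr 1
        ext1 w
        simp only [hT₁, he0, he1]
        split_ifs <;> rfl
      · obtain ⟨h1, h2⟩ := (T (e none)).val_pos ht
        rw [fst_plant]
        positivity
    · rw [hord, hsumV]
      have : ∀ w, (T₁ w).order = (T w).order + if w = u' then (T v).order else 0 := by
        intro w
        simp only [hT₁]
        split_ifs <;> simp [GraftTree.order]
      simp only [this, Finset.sum_add_distrib, Finset.sum_ite_eq', Finset.mem_univ, if_true]
      ring
    · rw [hlv, hsumV, if_pos hv]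
      -- A degree-one vertex counts as a leaf only if its own tree has none. At u' the graft
      -- supplies a leaf, so `max 1` is idle even if u' has become pendant in H; in G its degree is
      -- at least 2.
      have : ∀ w : {w // w ≠ v}, (if H.degree w = 1 then max 1 (T₁ w).leaves else (T₁ w).leaves) =
          (if G.degree w = 1 then max 1 (T w).leaves else (T w).leaves) +
            if w = u' then max 1 (T v).leaves else 0 := by
        intro w
        have hpos := hH.preconnected.degree_pos_of_nontrivial w
        simp only [hT₁, hdeg]
        by_cases hw : w = u'
        · simp only [hw, if_true, GraftTree.leaves] at hpos ⊢
          rw [if_neg (show ¬ H.degree w + 1 = 1 by omega)]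
          split_ifs <;> omega
        · simp [hw]
      simp only [this, Finset.sum_add_distrib, Finset.sum_ite_eq', Finset.mem_univ, if_true]
      ring

end SimpleGraph

/-! ### Determinants of the balanced unicyclic graphs. -/

/-- A dual number is a loaded rooted graph if its determinant is positive and its load is
nonnegative. -/
def IsLoaded (x : DualNumber ℝ) : Prop := 0 < x.fst ∧ 0 ≤ x.snd

theorem isLoaded_one : IsLoaded 1 := by simp [IsLoaded]

theorem IsLoaded.mul {x y : DualNumber ℝ} (hx : IsLoaded x) (hy : IsLoaded y) :
    IsLoaded (x * y) := by
  obtain ⟨h1, h2⟩ := hx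
  obtain ⟨h3, h4⟩ := hy
  simp only [IsLoaded, TrivSqZeroExt.fst_mul, dual_snd_mul]
  constructor <;> positivity

theorem IsLoaded.plant {t : ℝ} (ht : 0 < t) {x : DualNumber ℝ} (hx : IsLoaded x) :
    IsLoaded (plant t x) := by
  obtain ⟨h1, h2⟩ := hx
  simp only [IsLoaded, fst_plant, snd_plant]
  constructor <;> positivity

theorem IsLoaded.iterate_plant {t : ℝ} (ht : 0 < t) {x : DualNumber ℝ} (hx : IsLoaded x) (k : ℕ) :
    IsLoaded ((_root_.plant t)^[k] x) := by
  induction k with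
  | zero => exact hx
  | succ k ih => rw [Function.iterate_succ_apply']; exact ih.plant ht

/-- The graph on `0, …, m - 1` in which each vertex `v` is joined to `par v`, and `0` is joined to
`g - 1`. -/
def parentGraph (g : ℕ) (par : ℕ → ℕ) (m : ℕ) : SimpleGraph (Fin m) :=
  SimpleGraph.fromRel fun a b : Fin m => (a : ℕ) = par b ∨ ((a : ℕ) = 0 ∧ (b : ℕ) = g - 1)

/-- Eliminating the vertices `n - 1, …, g` of a graph given by a parent function. -/
theorem lapDet_parentGraph {g n : ℕ} (hg : 1 ≤ g) (hgn : g ≤ n) {par : ℕ → ℕ} (h0 : par 0 = 0)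
    (hpar : ∀ v, 0 < v → v < n → par v < v) (t : ℝ) (ht : 0 < t) (y : ℕ → DualNumber ℝ)
    (hload : ∀ v, IsLoaded (y v))
    (hy : ∀ v < n, y v = ∏ c ∈ Finset.Ico g n with par c = v, plant t (y c)) :
    lapDet t (parentGraph g par n) 1 = lapDet t (parentGraph g par g) (fun i => y i) := by
  -- After elimination down to m, each remaining vertex carries the product over its eliminated
  -- children only.
  have key : ∀ k m, m + k = n → g ≤ m → lapDet t (parentGraph g par n) 1 =
      lapDet t (parentGraph g par m)
        (fun i => ∏ c ∈ Finset.Ico m n with par c = i, plant t (y c)) := by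
    intro k
    induction k with
    | zero =>
      rintro m rfl -
      congr 1
      ext1 i
      simp
    | succ k ih =>
      intro m hm hgm
      rw [ih (m + 1) (by omega) (by omega)]
      have hlt : par m < m := hpar m (by omega) (by omega)
      have hadj : ∀ a b : Fin m, (parentGraph g par (m + 1)).Adj (finSuccEquivLast.symm (some a))
          (finSuccEquivLast.symm (some b)) ↔ (parentGraph g par m).Adj a b := by
        intro a b
        simp only [parentGraph, SimpleGraph.fromRel_adj, finSuccEquivLast_symm_some, Fin.ext_iff,
          Fin.val_castSucc, ne_eq]
      have hu : ∀ a : Fin m, (parentGraph g par (m + 1)).Adj (finSuccEquivLast.symm none)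
          (finSuccEquivLast.symm (some a)) ↔ a = ⟨par m, hlt⟩ := by
        intro a
        have ha := a.2
        have hne : par a ≠ m := by
          rcases Nat.eq_zero_or_pos (a : ℕ) with h | h
          · rw [h, h0]; omega
          · have := hpar a h (by omega)
            omega
        have hne' : Fin.last m ≠ a.castSucc := (Fin.castSucc_lt_last a).ne'
        simp only [parentGraph, SimpleGraph.fromRel_adj, finSuccEquivLast_symm_none,
          finSuccEquivLast_symm_some, Fin.val_last, Fin.val_castSucc, Fin.ext_iff] at hne' ⊢
        omega
      -- Children have larger numbers than their parent, so all children of m are gone when m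
      -- becomes pendant.
      have hym : ∏ c ∈ Finset.Ico (m + 1) n with par c = m, plant t (y c) = y m := by
        rw [hy m (by omega)]
        refine Finset.prod_congr ?_ fun _ _ => rfl
        ext c
        simp only [Finset.mem_filter, Finset.mem_Ico]
        refine ⟨fun h => by omega, fun ⟨h1, h2⟩ => ⟨?_, h2⟩⟩
        have := hpar c (by omega) (by omega)
        omega
      rw [lapDet_pendant finSuccEquivLast.symm hadj hu]
      · congr 1
        ext1 i
        simp only [finSuccEquivLast_symm_none, finSuccEquivLast_symm_some, Fin.val_last,
          Fin.val_castSucc, hym]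
        rw [← Finset.insert_Ico_add_one_left_eq_Ico (show m < n by omega), Finset.filter_insert]
        have hiff : par m = i ↔ i = ⟨par m, hlt⟩ := by
          rw [Fin.ext_iff, eq_comm]
        simp only [hiff]
        split_ifs
        · rw [Finset.prod_insert (by simp), mul_comm]
        · rfl
      · simp only [finSuccEquivLast_symm_none, Fin.val_last, hym]
        exact ((hload m).plant ht).1.ne'
  rw [key (n - g) g (by omega) le_rfl]
  congr 1
  ext1 i
  exact (hy i (by omega)).symm

/-- The loaded rooted graph of a pendent path with `k` edges at the root. -/
def pathVal (t : ℝ) (k : ℕ) : DualNumber ℝ := (plant t)^[k] 1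

/-- The loaded rooted graph of a starlike tree whose legs have the lengths `L`, rooted at its
centre. -/
noncomputable def legsVal (t : ℝ) (L : Multiset ℕ) : DualNumber ℝ := (L.map (pathVal t)).prod

theorem isLoaded_pathVal {t : ℝ} (ht : 0 < t) (k : ℕ) : IsLoaded (pathVal t k) :=
  isLoaded_one.iterate_plant ht k

theorem isLoaded_legsVal {t : ℝ} (ht : 0 < t) (L : Multiset ℕ) : IsLoaded (legsVal t L) :=
  Multiset.prod_induction IsLoaded _ (fun _ _ => IsLoaded.mul) isLoaded_one fun x hx => by
    obtain ⟨k, _, rfl⟩ := Multiset.mem_map.1 hx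
    exact isLoaded_pathVal ht k

/-- The lengths of `l` balanced legs of total length `s`. -/
def balancedLegs (l s : ℕ) : Multiset ℕ := (Multiset.range l).map fun j => (s - 1 - j) / l + 1

/-- Everything off the cycle hangs at vertex 0, so eliminating it leaves a single decorated cycle
vertex. -/
theorem lapDet_balancedUnicyclic_parentGraph {g l p s : ℕ} (hg : 1 ≤ g) (hls : l ≤ s)
    (hl : l = 0 → s = 0) (t : ℝ) (ht : 0 < t) :
    lapDet t (balancedUnicyclic (g + p + s) l g p) 1 =
      lapDet t (parentGraph g (starlikeParent g l p) g) (fun i =>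
        if (i : ℕ) = 0 then (plant t)^[p] (legsVal t (balancedLegs l s)) else 1) := by
  set Λ := legsVal t (balancedLegs l s) with hΛ
  have hΛp : Λ = ∏ j ∈ Finset.range l, plant t (pathVal t ((s - 1 - j) / l)) := by
    rw [hΛ, legsVal, balancedLegs, Multiset.map_map, Finset.prod_eq_multiset_prod,
      Finset.range_val]
    congr 1
    refine Multiset.map_congr rfl fun j _ => ?_
    simp only [Function.comp_apply, pathVal, Function.iterate_succ_apply']
  -- Below a leg vertex v lie v + l, v + 2l, … up to the last vertex, which explains the quotient by
  -- l.
  let y : ℕ → DualNumber ℝ := fun v =>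
    if g + p ≤ v then pathVal t ((g + p + s - 1 - v) / l)
    else if g ≤ v then (plant t)^[g + p - 1 - v] Λ
    else if v = 0 then (plant t)^[p] Λ else 1
  have hcentre : ∏ c ∈ Finset.Ico (g + p) (g + p + l), plant t (y c) = Λ := by
    rw [Finset.prod_Ico_eq_prod_range, hΛp, Nat.add_sub_cancel_left]
    refine Finset.prod_congr rfl fun j _ => ?_
    simp only [y]
    rw [if_pos (by omega)]
    congr 3
    omega
  have hload : ∀ v, IsLoaded (y v) := by
    intro v
    simp only [y]
    split_ifs
    · exact isLoaded_pathVal ht _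
    · exact (isLoaded_legsVal ht _).iterate_plant ht _
    · exact (isLoaded_legsVal ht _).iterate_plant ht _
    · exact isLoaded_one
  have hfilter : ∀ v (S : Finset ℕ), (∀ c, (g ≤ c ∧ c < g + p + s) ∧ starlikeParent g l p c = v ↔
      c ∈ S) → {c ∈ Finset.Ico g (g + p + s) | starlikeParent g l p c = v} = S := by
    intro v S h
    ext c
    rw [Finset.mem_filter, Finset.mem_Ico]
    exact h c
  refine (lapDet_parentGraph hg (by omega) ?_ ?_ t ht y hload ?_).trans ?_
  · simp [starlikeParent, show 0 < g by omega]
  · intro v hv _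
    unfold starlikeParent
    split_ifs <;> omega
  · intro v hv
    rcases Nat.lt_or_ge v (g + p) with h1 | h1
    · by_cases hc : v = if p = 0 then 0 else g + p - 1
      · rw [hfilter v (Finset.Ico (g + p) (g + p + l)), hcentre]
        · simp only [y]
          split_ifs at hc with hp
          · simp [hc, hp, show g ≠ 0 by omega]
          · rw [if_neg (by omega), if_pos (by omega), hc, Nat.sub_self]
            rfl
        · intro c
          rw [Finset.mem_Ico]
          unfold starlikeParent
          split_ifs at hc ⊢ <;> omega
      rcases Nat.lt_or_ge v g with h2 | h2
      · rcases Nat.eq_zero_or_pos v with h3 | h3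
        · have hp : p ≠ 0 := by
            rintro rfl
            exact hc (by simpa using h3)
          rw [hfilter v {g}, Finset.prod_singleton]
          · simp only [y]
            rw [if_neg (by omega), if_neg (by omega), if_pos h3, if_neg (by omega),
              if_pos (by omega), ← Function.iterate_succ_apply' (plant t)]
            congr 1
            omega
          · intro c
            rw [Finset.mem_singleton]
            unfold starlikeParent
            split_ifs at hc ⊢ <;> omega
        · rw [hfilter v ∅, Finset.prod_empty]
          · simp only [y]
            rw [if_neg (by omega), if_neg (by omega), if_neg (by omega)]
          · intro c
            simp only [Finset.notMem_empty, iff_false]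
            unfold starlikeParent
            split_ifs at hc ⊢ <;> omega
      · have hp : p ≠ 0 := by omega
        rw [if_neg hp] at hc
        rw [hfilter v {v + 1}, Finset.prod_singleton]
        · simp only [y]
          rw [if_neg (by omega), if_pos (by omega), if_neg (by omega),
              if_pos (by omega), ← Function.iterate_succ_apply' (plant t)]
          congr 1
          omega
        · intro c
          rw [Finset.mem_singleton]
          unfold starlikeParent
          split_ifs <;> omega
    · have hl0 : 0 < l := by
        by_contra h
        have := hl (by omega)
        omega
      rcases Nat.lt_or_ge (v + l) (g + p + s) with h2 | h2
      · rw [hfilter v {v + l}, Finset.prod_singleton]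
        · simp only [y]
          rw [if_pos h1, if_pos (by omega), pathVal, pathVal, ← Function.iterate_succ_apply' (plant t)]
          congr 1
          rw [Nat.succ_eq_add_one, ← Nat.add_div_right _ hl0]
          congr 1
          omega
        · intro c
          rw [Finset.mem_singleton]
          unfold starlikeParent
          split_ifs <;> omega
      · rw [hfilter v ∅, Finset.prod_empty]
        · simp only [y]
          rw [if_pos h1, Nat.div_eq_of_lt (by omega)]
          rfl
        · intro c
          simp only [Finset.notMem_empty, iff_false]
          unfold starlikeParent
          split_ifs <;> omega
  · congr 1
    ext1 i
    simp only [y]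
    rw [if_neg (by omega), if_neg (by omega)]

/-! ### Comparing determinants and loads. -/

/-- The determinant of a loaded rooted graph with load `t` at its root. -/
def total (t : ℝ) (x : DualNumber ℝ) : ℝ := x.snd + t * x.fst

/-- The order on loaded rooted graphs that compares the determinants for all loads at the root that
are at least `t`. -/
def DetLE (t : ℝ) (x y : DualNumber ℝ) : Prop := x.fst ≤ y.fst ∧ total t x ≤ total t y

/-- The load of `x` is at most the load of `y`. -/
def LoadLE (x y : DualNumber ℝ) : Prop := x.snd * y.fst ≤ y.snd * x.fst

theorem DetLE.refl (t : ℝ) (x : DualNumber ℝ) : DetLE t x x := ⟨le_rfl, le_rfl⟩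

theorem DetLE.trans {t : ℝ} {x y z : DualNumber ℝ} (h : DetLE t x y) (h' : DetLE t y z) :
    DetLE t x z := ⟨h.1.trans h'.1, h.2.trans h'.2⟩

theorem DetLE.mul_left {t : ℝ} {x y z : DualNumber ℝ} (hz : IsLoaded z) (h : DetLE t x y) :
    DetLE t (z * x) (z * y) := by
  obtain ⟨hz1, hz2⟩ := hz
  obtain ⟨h1, h2⟩ := h
  simp only [DetLE, total, TrivSqZeroExt.fst_mul, dual_snd_mul] at *
  have e1 := mul_le_mul_of_nonneg_left h1 hz1.le
  have e2 := mul_le_mul_of_nonneg_left h2 hz1.le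
  have e3 := mul_le_mul_of_nonneg_left h1 hz2
  exact ⟨e1, by linarith⟩

theorem DetLE.mul {t : ℝ} {x y z w : DualNumber ℝ} (hx : IsLoaded x) (hw : IsLoaded w)
    (h : DetLE t x y) (h' : DetLE t z w) : DetLE t (x * z) (y * w) := by
  refine (h'.mul_left hx).trans ?_
  rw [mul_comm x, mul_comm y]
  exact h.mul_left hw

theorem DetLE.plant {t : ℝ} (ht : 0 < t) {x y : DualNumber ℝ} (h : DetLE t x y) :
    DetLE t (plant t x) (plant t y) := by
  obtain ⟨h1, h2⟩ := h
  simp only [DetLE, total, fst_plant, snd_plant] at *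
  have := mul_le_mul_of_nonneg_left h2 ht.le
  have := mul_le_mul_of_nonneg_left h1 ht.le
  constructor <;> linarith

theorem LoadLE.trans {x y z : DualNumber ℝ} (hx : IsLoaded x) (hy : IsLoaded y) (hz : IsLoaded z)
    (h : LoadLE x y) (h' : LoadLE y z) : LoadLE x z := by
  have e1 := mul_le_mul_of_nonneg_left h hz.1.le
  have e2 := mul_le_mul_of_nonneg_left h' hx.1.le
  refine le_of_mul_le_mul_right ?_ hy.1
  linarith

/-- `plant t` is linear with determinant (1 + t) − t = 1, so it preserves the cross product that
compares the loads. -/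
theorem loadLE_plant_iff {t : ℝ} {x y : DualNumber ℝ} :
    LoadLE (plant t x) (plant t y) ↔ LoadLE x y := by
  simp only [LoadLE, fst_plant, snd_plant]
  rw [← sub_nonneg, ← sub_nonneg (a := y.snd * x.fst)]
  ring_nf

theorem loadLE_iterate_plant_iff {t : ℝ} {x y : DualNumber ℝ} (k : ℕ) :
    LoadLE ((plant t)^[k] x) ((plant t)^[k] y) ↔ LoadLE x y := by
  induction k with
  | zero => rfl
  | succ k ih => rw [Function.iterate_succ_apply', Function.iterate_succ_apply', loadLE_plant_iff, ih]

theorem LoadLE.mul_right {x y z : DualNumber ℝ} (hx : IsLoaded x) (hy : IsLoaded y)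
    (hz : IsLoaded z) (h : LoadLE x y) : LoadLE x (y * z) := by
  obtain ⟨hx1, -⟩ := hx
  obtain ⟨hy1, -⟩ := hy
  obtain ⟨hz1, hz2⟩ := hz
  simp only [LoadLE, TrivSqZeroExt.fst_mul, dual_snd_mul] at *
  have e1 := mul_le_mul_of_nonneg_right h hz1.le
  have e2 : 0 ≤ y.fst * z.snd * x.fst := by positivity
  linarith

theorem loadLE_one {x : DualNumber ℝ} (hx : IsLoaded x) : LoadLE 1 x := by
  simpa [LoadLE] using hx.2

/-- The two-terminal network of a path with `k` edges is symmetric. -/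
theorem exists_iterate_plant_eq {t : ℝ} (ht : 0 < t) (k : ℕ) :
    ∃ δ β : ℝ, 0 ≤ δ ∧ 0 ≤ β ∧ ∀ x : DualNumber ℝ,
      ((plant t)^[k] x).fst = (δ + t * β) * x.fst + β * x.snd ∧
      ((plant t)^[k] x).snd = t * β * x.fst + δ * x.snd := by
  induction k with
  | zero => exact ⟨1, 0, by simp⟩
  | succ k ih =>
    obtain ⟨δ, β, hδ, hβ, h⟩ := ih
    refine ⟨t * β + δ, (1 + t) * β + δ, by positivity, by positivity, fun x => ?_⟩
    obtain ⟨h1, h2⟩ := h x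
    rw [Function.iterate_succ_apply', fst_plant, snd_plant, h1, h2]
    constructor <;> ring

/-- Both sides are the determinant of the same graph, x and y joined by a path of k edges, rooted at
either end of it. -/
theorem total_iterate_plant_mul {t : ℝ} (ht : 0 < t) (k : ℕ) (x y : DualNumber ℝ) :
    total t ((plant t)^[k] x * y) = total t (x * (plant t)^[k] y) := by
  obtain ⟨δ, β, -, -, h⟩ := exists_iterate_plant_eq ht k
  simp only [total, TrivSqZeroExt.fst_mul, dual_snd_mul, (h x).1, (h x).2, (h y).1, (h y).2]
  ring

/-- Moving the root along a path, from the end with the smaller load to the one with the larger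
load. -/
theorem LoadLE.detLE_mul_iterate_plant {t : ℝ} (ht : 0 < t) {x y : DualNumber ℝ}
    (h : LoadLE x y) (k : ℕ) : DetLE t (y * (plant t)^[k] x) (x * (plant t)^[k] y) := by
  refine ⟨?_, ?_⟩
  · obtain ⟨δ, β, -, hβ, hk⟩ := exists_iterate_plant_eq ht k
    have := mul_le_mul_of_nonneg_left h hβ
    simp only [TrivSqZeroExt.fst_mul, (hk x).1, (hk y).1]
    linarith
  · rw [mul_comm x, total_iterate_plant_mul ht]

/-- Moving branches `b` along a path, to the root, if the other branches `c` at its other end have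
load at most the load at the root. -/
theorem LoadLE.detLE_mul_mul_iterate_plant {t : ℝ} (ht : 0 < t) {a b c : DualNumber ℝ}
    (ha : IsLoaded a) (hb : IsLoaded b) (hc : IsLoaded c) (h : LoadLE c a) (k : ℕ) :
    DetLE t (a * b * (plant t)^[k] c) (a * (plant t)^[k] (c * b)) := by
  obtain ⟨δ, β, hδ, hβ, hk⟩ := exists_iterate_plant_eq ht k
  obtain ⟨ha1, ha2⟩ := ha
  obtain ⟨hb1, hb2⟩ := hb
  obtain ⟨hc1, hc2⟩ := hc
  simp only [DetLE, total, TrivSqZeroExt.fst_mul, dual_snd_mul, (hk c).1, (hk c).2,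
    (hk (c * b)).1, (hk (c * b)).2]
  constructor
  -- With the root deleted the inequality holds for any loads; only the total needs a to be heavier
  -- than c.
  · have : 0 ≤ a.fst * β * c.fst * b.snd := by positivity
    linarith
  · have := mul_le_mul_of_nonneg_left h (mul_nonneg hβ hb2)
    linarith

/-! ### From rooted trees to starlike trees. -/

theorem pathVal_add (t : ℝ) (j k : ℕ) : pathVal t (j + k) = (plant t)^[j] (pathVal t k) :=
  Function.iterate_add_apply _ _ _ _

theorem pathVal_succ (t : ℝ) (k : ℕ) : pathVal t (k + 1) = plant t (pathVal t k) :=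
  Function.iterate_succ_apply' _ _ _

/-- Cancelling the j common edges leaves a bare vertex, of load zero, against a path. -/
theorem loadLE_pathVal {t : ℝ} (ht : 0 < t) {j k : ℕ} (h : j ≤ k) :
    LoadLE (pathVal t j) (pathVal t k) := by
  obtain ⟨d, rfl⟩ := Nat.exists_eq_add_of_le h
  rw [pathVal_add]
  exact (loadLE_iterate_plant_iff j).2 (loadLE_one (isLoaded_pathVal ht d))

theorem legsVal_cons (t : ℝ) (a : ℕ) (L : Multiset ℕ) :
    legsVal t (a ::ₘ L) = pathVal t a * legsVal t L := by simp [legsVal]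

theorem legsVal_add (t : ℝ) (L M : Multiset ℕ) :
    legsVal t (L + M) = legsVal t L * legsVal t M := by simp [legsVal]

theorem legsVal_singleton (t : ℝ) (a : ℕ) : legsVal t {a} = pathVal t a := by simp [legsVal]

theorem loadLE_legsVal {t : ℝ} (ht : 0 < t) {j : ℕ} {L : Multiset ℕ} (h : ∃ a ∈ L, j ≤ a) :
    LoadLE (pathVal t j) (legsVal t L) := by
  obtain ⟨a, ha, hja⟩ := h
  obtain ⟨M, rfl⟩ := Multiset.exists_cons_of_mem ha
  rw [legsVal_cons]
  exact (loadLE_pathVal ht hja).mul_right (isLoaded_pathVal ht _) (isLoaded_pathVal ht _)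
    (isLoaded_legsVal ht _)

theorem loadLE_iterate_plant_legsVal {t : ℝ} (ht : 0 < t) (p : ℕ) {j : ℕ} {L : Multiset ℕ}
    (h : ∃ a ∈ L, j ≤ a) : LoadLE (pathVal t j) ((plant t)^[p] (legsVal t L)) := by
  refine (loadLE_pathVal ht (Nat.le_add_left j p)).trans (isLoaded_pathVal ht _)
    (isLoaded_pathVal ht _) ((isLoaded_legsVal ht _).iterate_plant ht _) ?_
  rw [pathVal_add]
  exact (loadLE_iterate_plant_iff p).2 (loadLE_legsVal ht h)

theorem Multiset.exists_mem_forall_le {L : Multiset ℕ} (hL : L ≠ 0) :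
    ∃ x ∈ L, ∀ a ∈ L, x ≤ a := by
  obtain ⟨a, ha⟩ := Multiset.exists_mem_of_ne_zero hL
  obtain ⟨x, hx, h⟩ := L.toFinset.exists_min_image id ⟨a, Multiset.mem_toFinset.2 ha⟩
  exact ⟨x, Multiset.mem_toFinset.1 hx, fun b hb => h b (Multiset.mem_toFinset.2 hb)⟩

/-- A starlike tree and a starlike tree at the end of a path, joined at the roots, can be replaced
by one starlike tree. -/
theorem exists_detLE_legsVal_mul {L K : Multiset ℕ} (hL : L ≠ 0) (hK : K ≠ 0) (q : ℕ) :
    ∃ M : Multiset ℕ, M.card = L.card + K.card ∧ M.sum = L.sum + (q + K.sum) ∧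
      ∀ t : ℝ, 0 < t → DetLE t (legsVal t M) (legsVal t L * (plant t)^[q] (legsVal t K)) := by
  -- The overall shortest leg is no heavier than the other starlike tree. The remaining branches at
  -- its centre move over to the other centre, and it becomes a leg of length q + x.
  obtain ⟨x, hx, hmin⟩ := Multiset.exists_mem_forall_le (L := L + K) (by simp [hL])
  obtain ⟨a, ha⟩ := Multiset.exists_mem_of_ne_zero hL
  obtain ⟨b, hb⟩ := Multiset.exists_mem_of_ne_zero hK
  rcases Multiset.mem_add.1 hx with hx | hx
  · obtain ⟨L', rfl⟩ := Multiset.exists_cons_of_mem hx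
    refine ⟨(q + x) ::ₘ (L' + K), by simp; ring, by simp; ring, fun t ht => ?_⟩
    have h := (loadLE_legsVal ht ⟨b, hb, hmin b (by simp [hb])⟩).detLE_mul_iterate_plant ht q
    convert h.mul_left (isLoaded_legsVal ht L') using 1
    · rw [legsVal_cons, legsVal_add, pathVal_add]
      ring
    · rw [legsVal_cons]
      ring
  · obtain ⟨K', rfl⟩ := Multiset.exists_cons_of_mem hx
    refine ⟨(q + x) ::ₘ (L + K'), by simp; ring, by simp; ring, fun t ht => ?_⟩
    have h := (loadLE_legsVal ht ⟨a, ha, hmin a (by simp [ha])⟩).detLE_mul_mul_iterate_plant ht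
      (isLoaded_legsVal ht L) (isLoaded_legsVal ht K') (isLoaded_pathVal ht x) q
    convert h using 1
    · rw [legsVal_cons, legsVal_add, pathVal_add]
      ring
    · rw [legsVal_cons]

/-- The legs of K other than a shortest one move to the root. The root is then the centre of a
starlike tree with a leg q + x, and `exists_detLE_legsVal_mul` merges it with the tree at the end of
the other path. -/
theorem exists_detLE_iterate_plant_mul_aux {L K : Multiset ℕ} (hL : L ≠ 0) (p q : ℕ) {x : ℕ}
    (hxK : x ∈ K) (hmin : ∀ a ∈ L, x ≤ a) :
    ∃ M : Multiset ℕ, M.card = L.card + K.card ∧ M.sum = p + L.sum + (q + K.sum) ∧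
      ∀ t : ℝ, 0 < t →
        DetLE t (legsVal t M) ((plant t)^[p] (legsVal t L) * (plant t)^[q] (legsVal t K)) := by
  obtain ⟨a, ha⟩ := Multiset.exists_mem_of_ne_zero hL
  obtain ⟨K', rfl⟩ := Multiset.exists_cons_of_mem hxK
  obtain ⟨M, hcard, hsum, hM⟩ :=
    exists_detLE_legsVal_mul (L := (q + x) ::ₘ K') (by simp) hL p
  refine ⟨M, by rw [hcard]; simp; ring, by rw [hsum]; simp; ring, fun t ht => ?_⟩
  refine (hM t ht).trans ?_
  have h := (loadLE_iterate_plant_legsVal ht p ⟨a, ha, hmin a ha⟩).detLE_mul_mul_iterate_plant ht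
    ((isLoaded_legsVal ht L).iterate_plant ht p) (isLoaded_legsVal ht K') (isLoaded_pathVal ht x) q
  convert h using 1
  · rw [legsVal_cons, pathVal_add]
    ring
  · rw [legsVal_cons]

/-- Two starlike trees at the ends of paths that start at the root can be replaced by one starlike
tree. -/
theorem exists_detLE_iterate_plant_mul {L K : Multiset ℕ} (hL : L ≠ 0) (hK : K ≠ 0) (p q : ℕ) :
    ∃ M : Multiset ℕ, M.card = L.card + K.card ∧ M.sum = p + L.sum + (q + K.sum) ∧
      ∀ t : ℝ, 0 < t →
        DetLE t (legsVal t M) ((plant t)^[p] (legsVal t L) * (plant t)^[q] (legsVal t K)) := by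
  obtain ⟨x, hx, hmin⟩ := Multiset.exists_mem_forall_le (L := L + K) (by simp [hL])
  rcases Multiset.mem_add.1 hx with hx | hx
  · obtain ⟨M, h1, h2, h3⟩ := exists_detLE_iterate_plant_mul_aux hK q p hx
      fun a ha => hmin a (by simp [ha])
    exact ⟨M, by omega, by omega, fun t ht => by rw [mul_comm]; exact h3 t ht⟩
  · exact exists_detLE_iterate_plant_mul_aux hL p q hx fun a ha => hmin a (by simp [ha])

namespace GraftTree

theorem leaves_add_one_le_order (T : GraftTree) : T.leaves + 1 ≤ T.order := by
  induction T with
  | single => simp [leaves, order]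
  | graft T S hT hS =>
    simp only [leaves, order]
    omega

/-- Every rooted tree can be replaced by a starlike tree at the end of a path. -/
theorem exists_detLE (T : GraftTree) :
    ∃ (p : ℕ) (L : Multiset ℕ), L.card = T.leaves ∧ p + L.sum + 1 = T.order ∧
      ∀ t : ℝ, 0 < t → DetLE t ((plant t)^[p] (legsVal t L)) (T.val t) := by
  induction T with
  | single => exact ⟨0, 0, rfl, rfl, fun t _ => DetLE.refl _ _⟩
  | graft T S hT hS =>
    obtain ⟨q, K, hK0, hK, hKsum, hKdet⟩ : ∃ (q : ℕ) (K : Multiset ℕ), K ≠ 0 ∧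
        K.card = max 1 S.leaves ∧ q + K.sum = S.order ∧
        ∀ t : ℝ, 0 < t → DetLE t ((plant t)^[q] (legsVal t K)) (plant t (S.val t)) := by
      obtain ⟨q, K, hK, hKsum, hKdet⟩ := hS
      -- Without legs the replacement is a bare path, which together with the new edge forms a
      -- single leg.
      rcases eq_or_ne K 0 with rfl | hK0
      · refine ⟨0, {q + 1}, by simp, ?_, ?_, fun t ht => ?_⟩
        · simp [← hK]
        · simpa using hKsum
        · have := (hKdet t ht).plant ht
          rw [← Function.iterate_succ_apply' (plant t)] at this
          change DetLE t (legsVal t {q + 1}) _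
          rw [legsVal_singleton]
          exact this
      · refine ⟨q + 1, K, hK0, ?_, by omega, fun t ht => ?_⟩
        · have := Multiset.card_pos.2 hK0
          omega
        · rw [Function.iterate_succ_apply']
          exact (hKdet t ht).plant ht
    -- Only a bare root keeps the path leading to the centre; otherwise the two starlike trees merge
    -- at the root.
    cases T with
    | single =>
      refine ⟨q, K, by simpa [leaves] using hK, by simp only [order]; omega, fun t ht => ?_⟩
      simpa [val] using hKdet t ht
    | graft T T' =>
      obtain ⟨p, L, hL, hLsum, hLdet⟩ := hT
      have hL0 : L ≠ 0 := by
        rw [← Multiset.card_pos, hL, leaves]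
        omega
      obtain ⟨M, hM, hMsum, hMdet⟩ := exists_detLE_iterate_plant_mul hL0 hK0 p q
      refine ⟨0, M, by rw [hM, hL, hK]; rfl, ?_, fun t ht => ?_⟩
      · rw [order]
        omega
      · exact (hMdet t ht).trans ((hLdet t ht).mul ((isLoaded_legsVal ht _).iterate_plant ht _)
          (IsLoaded.plant ht (val_pos ht S)) (hKdet t ht))

end GraftTree

/-! ### Shortening the path and balancing the legs. -/

/-- Lengthening the shortest leg at the cost of the path that leads to a heavy loaded rooted graph
`C t`. -/
theorem exists_total_le {C : ℝ → DualNumber ℝ} {j : ℕ} (hC : ∀ t, 0 < t → IsLoaded (C t))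
    (hj : ∀ t, 0 < t → LoadLE (pathVal t j) (C t)) (p : ℕ) :
    ∀ {L : Multiset ℕ}, L ≠ 0 → ∃ (i : ℕ) (M : Multiset ℕ), M.card = L.card ∧
      i + M.sum = p + L.sum ∧ i ≤ (p + L.sum - j * L.card) / (L.card + 1) ∧
      ∀ t : ℝ, 0 < t → total t (C t * (plant t)^[i] (legsVal t M)) ≤
        total t (C t * (plant t)^[p] (legsVal t L)) := by
  induction p with
  | zero => exact fun {L} _ => ⟨0, L, rfl, rfl, Nat.zero_le _, fun _ _ => le_rfl⟩
  | succ p ih =>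
    intro L hL
    by_cases hp : p + 1 ≤ (p + 1 + L.sum - j * L.card) / (L.card + 1)
    · exact ⟨p + 1, L, rfl, rfl, hp, fun _ _ => le_rfl⟩
    obtain ⟨x, hx, hmin⟩ := Multiset.exists_mem_forall_le hL
    have hxsum : L.card * x ≤ L.sum := by
      simpa using Multiset.card_nsmul_le_sum hmin
    -- If every leg had length at least p + j + 1, the path length p + 1 would meet the bound.
    have hxp : x ≤ p + j := by
      rw [not_le, Nat.div_lt_iff_lt_mul (by omega)] at hp
      by_contra h
      have h1 : p + j + 1 ≤ x := by omega
      have h2 := (Nat.mul_le_mul_left L.card h1).trans hxsum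
      have h3 : p + 1 + L.sum - j * L.card < (p + 1) * (L.card + 1) := hp
      have h4 : p + 1 + L.sum < (p + 1) * (L.card + 1) + j * L.card := by omega
      nlinarith
    obtain ⟨L', rfl⟩ := Multiset.exists_cons_of_mem hx
    obtain ⟨i, M, hM, hsum, hi, hdet⟩ := ih (L := (x + 1) ::ₘ L') (by simp)
    simp only [Multiset.card_cons, Multiset.sum_cons] at *
    have e : p + (x + 1 + L'.sum) = p + 1 + (x + L'.sum) := by ring
    rw [e] at hsum hi
    refine ⟨i, M, hM, hsum, hi, fun t ht => (hdet t ht).trans ?_⟩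
    have hload : LoadLE (pathVal t x) ((plant t)^[p] (C t)) := by
      refine (loadLE_pathVal ht hxp).trans (isLoaded_pathVal ht _) (isLoaded_pathVal ht _)
        ((hC t ht).iterate_plant ht _) ?_
      rw [pathVal_add]
      exact (loadLE_iterate_plant_iff p).2 (hj t ht)
    have h := (hload.detLE_mul_iterate_plant ht 1).mul_left (isLoaded_legsVal ht L')
    -- Rerooted at the centre, the two graphs differ by one edge, moved from the path towards `C t`
    -- to the lighter leg x.
    rw [← total_iterate_plant_mul ht, ← total_iterate_plant_mul ht]
    refine (le_of_eq ?_).trans (h.2.trans (le_of_eq ?_))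
    · rw [legsVal_cons, pathVal_succ, Function.iterate_one]
      congr 1
      ring
    · rw [legsVal_cons, Function.iterate_succ_apply' (plant t) p, Function.iterate_one]
      congr 1
      ring

theorem Multiset.eq_replicate_add_replicate {L : Multiset ℕ} (hL : L ≠ 0)
    (h : ∀ a ∈ L, ∀ b ∈ L, a ≤ b + 1) :
    L = Multiset.replicate (L.card - L.sum % L.card) (L.sum / L.card) +
      Multiset.replicate (L.sum % L.card) (L.sum / L.card + 1) := by
  obtain ⟨m, hm, hmin⟩ := Multiset.exists_mem_forall_le hL
  obtain ⟨c, d, hc, hcd⟩ : ∃ c d, 0 < c ∧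
      L = Multiset.replicate c m + Multiset.replicate d (m + 1) := by
    refine ⟨L.count m, (L.filter (· ≠ m)).card, Multiset.count_pos.2 hm, ?_⟩
    conv_lhs => rw [← Multiset.filter_add_not (· = m) L, Multiset.filter_eq']
    congr 1
    refine Multiset.eq_replicate.2 ⟨rfl, fun b hb => ?_⟩
    obtain ⟨hb, hbm⟩ := Multiset.mem_filter.1 hb
    have := hmin b hb
    have := h b hb m hm
    omega
  have hcard : L.card = c + d := by rw [hcd]; simp
  have hsum : L.sum = d + (c + d) * m := by rw [hcd]; simp; ring
  have hmod : L.sum % L.card = d := by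
    rw [hcard, hsum, Nat.add_mul_mod_self_left, Nat.mod_eq_of_lt (by omega)]
  have hdiv : L.sum / L.card = m := by
    rw [hcard, hsum, Nat.add_mul_div_left _ _ (by omega), Nat.div_eq_of_lt (by omega), zero_add]
  rw [hmod, hdiv, hcard, Nat.add_sub_cancel]
  exact hcd

/-- Among the starlike trees with given number and total length of the legs, the balanced one has
the smallest determinant. -/
theorem detLE_legsVal_of_balanced {t : ℝ} (ht : 0 < t) {M : Multiset ℕ} (hM0 : M ≠ 0)
    (hM : ∀ a ∈ M, ∀ b ∈ M, a ≤ b + 1) (k : ℕ) :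
    ∀ {L : Multiset ℕ}, (L.map (· ^ 2)).sum = k → L.card = M.card → L.sum = M.sum →
      DetLE t (legsVal t M) (legsVal t L) := by
  induction k using Nat.strong_induction_on with
  | _ k ih =>
    intro L hk hcard hsum
    by_cases hL : ∀ a ∈ L, ∀ b ∈ L, a ≤ b + 1
    · have hL0 : L ≠ 0 := by
        rw [← Multiset.card_pos, hcard]
        exact Multiset.card_pos.2 hM0
      rw [Multiset.eq_replicate_add_replicate hL0 hL, Multiset.eq_replicate_add_replicate hM0 hM,
        hcard, hsum]
      exact DetLE.refl _ _
    push Not at hL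
    obtain ⟨a, ha, b, hb, hab⟩ := hL
    obtain ⟨L₁, rfl⟩ := Multiset.exists_cons_of_mem ha
    have hb : b ∈ L₁ := by
      rcases Multiset.mem_cons.1 hb with h | h
      · omega
      · exact h
    obtain ⟨L₂, rfl⟩ := Multiset.exists_cons_of_mem hb
    obtain ⟨a, rfl⟩ : ∃ a', a = a' + 1 := ⟨a - 1, by omega⟩
    simp only [Multiset.card_cons, Multiset.sum_cons, Multiset.map_cons] at hk hcard hsum
    -- Moving an edge from the leg a + 1 to the leg b, with b < a, lowers the sum of squares.
    refine (ih _ ?_ (L := a ::ₘ (b + 1) ::ₘ L₂) rfl (by simpa using hcard) ?_).trans ?_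
    · simp only [Multiset.sum_cons, Multiset.map_cons]
      nlinarith
    · rw [← hsum, Multiset.sum_cons, Multiset.sum_cons]
      ring
    · have h := ((loadLE_pathVal ht (show b ≤ a by omega)).detLE_mul_iterate_plant ht 1).mul_left
        (isLoaded_legsVal ht L₂)
      convert h using 1
      · rw [legsVal_cons, legsVal_cons, pathVal_succ, Function.iterate_one]
        ring
      · rw [legsVal_cons, legsVal_cons, pathVal_succ, Function.iterate_one]
        ring

theorem card_balancedLegs (l s : ℕ) : (balancedLegs l s).card = l := by simp [balancedLegs]

/-- Dealing s vertices in turn to l legs gives each the quotient, and one more to the first s mod l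
of them. -/
theorem balancedLegs_eq {l s : ℕ} (hls : l ≤ s) :
    balancedLegs l s = (Multiset.range l).map fun j => s / l + if j < s % l then 1 else 0 := by
  refine Multiset.map_congr rfl fun j hj => ?_
  have hj : j < l := Multiset.mem_range.1 hj
  have hl : 0 < l := by omega
  have hr := Nat.mod_lt s hl
  have hs := Nat.div_add_mod s l
  rw [← Nat.add_div_right _ hl]
  split_ifs with h
  · have e : s - 1 - j + l = (s % l - 1 - j) + l * (s / l + 1) := by
      rw [Nat.mul_add_one]
      omega
    rw [e, Nat.add_mul_div_left _ _ hl, Nat.div_eq_of_lt (by omega), zero_add]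
  · have e : s - 1 - j + l = (s % l + l - 1 - j) + l * (s / l) := by omega
    rw [e, Nat.add_mul_div_left _ _ hl, Nat.div_eq_of_lt (by omega), zero_add, add_zero]

theorem sum_balancedLegs {l s : ℕ} (hl : 0 < l) (hls : l ≤ s) : (balancedLegs l s).sum = s := by
  have hr := (Nat.mod_lt s hl).le
  have : ((Finset.range l).filter (· < s % l)) = Finset.range (s % l) := by
    ext j
    simp only [Finset.mem_filter, Finset.mem_range]
    omega
  rw [balancedLegs_eq hls, ← Finset.range_val, ← Finset.sum_eq_multiset_sum,
    Finset.sum_add_distrib, Finset.sum_const, Finset.card_range, ← Finset.card_filter, this,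
    Finset.card_range, smul_eq_mul, Nat.div_add_mod]

theorem balancedLegs_le_add_one {l s : ℕ} (hls : l ≤ s) :
    ∀ a ∈ balancedLegs l s, ∀ b ∈ balancedLegs l s, a ≤ b + 1 := by
  rw [balancedLegs_eq hls]
  intro a ha b hb
  obtain ⟨i, -, rfl⟩ := Multiset.mem_map.1 ha
  obtain ⟨j, -, rfl⟩ := Multiset.mem_map.1 hb
  split_ifs <;> omega

/-! ### Triangle and quadrilateral as heavy rooted graphs. -/

/-- The loaded rooted graph of a triangle. -/
def triangleVal (t : ℝ) : DualNumber ℝ := ((1 + t) * (3 + t), 2 * t * (3 + t))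

/-- The loaded rooted graph of a quadrilateral. -/
def squareVal (t : ℝ) : DualNumber ℝ :=
  ((2 + t) * (t ^ 2 + 4 * t + 2), t * (t + 2) * (2 * t + 6))

@[simp]
theorem fst_triangleVal (t : ℝ) : (triangleVal t).fst = (1 + t) * (3 + t) := rfl

@[simp]
theorem snd_triangleVal (t : ℝ) : (triangleVal t).snd = 2 * t * (3 + t) := rfl

@[simp]
theorem fst_squareVal (t : ℝ) : (squareVal t).fst = (2 + t) * (t ^ 2 + 4 * t + 2) := rfl

@[simp]
theorem snd_squareVal (t : ℝ) : (squareVal t).snd = t * (t + 2) * (2 * t + 6) := rfl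

theorem isLoaded_triangleVal {t : ℝ} (ht : 0 < t) : IsLoaded (triangleVal t) := by
  rw [IsLoaded, fst_triangleVal, snd_triangleVal]
  constructor <;> positivity

theorem isLoaded_squareVal {t : ℝ} (ht : 0 < t) : IsLoaded (squareVal t) := by
  rw [IsLoaded, fst_squareVal, snd_squareVal]
  constructor <;> positivity

/-- As t tends to 0 a load is asymptotic to t times the number of vertices off the root, so 2 is the
longest possible path here, and 3 for the quadrilateral. These are the coefficients of l in the
bounds on p. -/
theorem loadLE_triangleVal {t : ℝ} (ht : 0 < t) : LoadLE (pathVal t 2) (triangleVal t) := by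
  simp only [LoadLE, fst_triangleVal, snd_triangleVal, pathVal,
    Function.iterate_succ, Function.iterate_zero, Function.comp_apply, id, fst_plant, snd_plant,
    TrivSqZeroExt.fst_one, TrivSqZeroExt.snd_one]
  rw [← sub_nonneg]
  ring_nf
  positivity

theorem loadLE_squareVal {t : ℝ} (ht : 0 < t) : LoadLE (pathVal t 3) (squareVal t) := by
  simp only [LoadLE, fst_squareVal, snd_squareVal, pathVal,
    Function.iterate_succ, Function.iterate_zero, Function.comp_apply, id, fst_plant, snd_plant,
    TrivSqZeroExt.fst_one, TrivSqZeroExt.snd_one]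
  rw [← sub_nonneg]
  ring_nf
  positivity

theorem SimpleGraph.Walk.IsCycle.exists_cycleGraph_hom {V : Type*} {G : SimpleGraph V} {a : V}
    {w : G.Walk a a} (hw : w.IsCycle) {m : ℕ} (hm : w.length = m + 3) :
    ∃ φ : SimpleGraph.cycleGraph (m + 3) →g G, Function.Injective φ := by
  have hadj : ∀ i : Fin (m + 3), G.Adj (w.getVert i) (w.getVert (i + 1 : Fin (m + 3))) := by
    intro i
    have h := w.adj_getVert_succ (i := i) (by omega)
    rw [Fin.val_add_one]
    split_ifs with hi
    · rw [hi, Fin.val_last, show m + 2 + 1 = w.length by omega, w.getVert_length] at h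
      rw [hi, Fin.val_last, w.getVert_zero]
      exact h
    · exact h
  refine ⟨⟨fun i => w.getVert i, ?_⟩, ?_⟩
  · intro i j hij
    rcases SimpleGraph.cycleGraph_adj.1 hij with h | h
    · rw [sub_eq_iff_eq_add'.1 h]
      exact (hadj j).symm
    · rw [sub_eq_iff_eq_add'.1 h]
      exact hadj i
  · intro i j hij
    refine Fin.ext (hw.getVert_injOn' ?_ ?_ hij) <;> simp <;> omega

/-! ### Identifying roots, and the common argument for both girths. -/

namespace GraftTree

/-- Two rooted trees with their roots identified. -/
def merge (T : GraftTree) : GraftTree → GraftTree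
  | single => T
  | graft S C => graft (merge T S) C

theorem val_merge (t : ℝ) (T S : GraftTree) : (T.merge S).val t = T.val t * S.val t := by
  induction S with
  | single => simp [merge, val]
  | graft S C ih => simp [merge, val, ih, mul_assoc]

theorem order_merge (T S : GraftTree) : (T.merge S).order + 1 = T.order + S.order := by
  induction S with
  | single => simp [merge, order]
  | graft S C ih =>
    simp only [merge, order]
    omega

theorem leaves_merge (T S : GraftTree) : (T.merge S).leaves = T.leaves + S.leaves := by
  induction S with
  | single => simp [merge, leaves]
  | graft S C ih => simp only [merge, leaves, ih, add_assoc]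

/-- Gluing all roots into one multiplies the dual numbers. The order loses one vertex per tree and
gains back the common root. -/
theorem exists_val_eq_prod {ι : Type*} (s : Finset ι) (f : ι → GraftTree) :
    ∃ T : GraftTree, (∀ t, T.val t = ∏ i ∈ s, (f i).val t) ∧
      T.order + s.card = ∑ i ∈ s, (f i).order + 1 ∧ T.leaves = ∑ i ∈ s, (f i).leaves := by
  classical
  induction s using Finset.induction_on with
  | empty => exact ⟨single, by simp [val], by simp [order], by simp [leaves]⟩
  | insert a s ha ih =>
    obtain ⟨T, h1, h2, h3⟩ := ih
    refine ⟨(f a).merge T, fun t => ?_, ?_, ?_⟩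
    · rw [val_merge, h1, Finset.prod_insert ha]
    · have := order_merge (f a) T
      rw [Finset.card_insert_of_notMem ha, Finset.sum_insert ha]
      omega
    · rw [leaves_merge, h3, Finset.sum_insert ha]

theorem order_eq_one_of_leaves {T : GraftTree} (h : T.leaves = 0) : T.order = 1 := by
  cases T with
  | single => rfl
  | graft T S =>
    simp only [leaves] at h
    omega

end GraftTree

/-- A rooted tree joined at its root with a heavy loaded rooted graph can be replaced by a balanced
starlike tree at the end of a short path. -/
theorem exists_total_balancedLegs_le {C : ℝ → DualNumber ℝ} {j : ℕ} (hj0 : 1 ≤ j)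
    (hC : ∀ t, 0 < t → IsLoaded (C t)) (hj : ∀ t, 0 < t → LoadLE (pathVal t j) (C t))
    (T : GraftTree) :
    ∃ i s, i + s + 1 = T.order ∧ T.leaves ≤ s ∧ (T.leaves = 0 → s = 0) ∧
      i ≤ (T.order - 1 - j * T.leaves) / (T.leaves + 1) ∧
      ∀ t : ℝ, 0 < t →
        total t (C t * (plant t)^[i] (legsVal t (balancedLegs T.leaves s))) ≤
          total t (C t * T.val t) := by
  obtain ⟨p, L, hL, hsum, hdet⟩ := T.exists_detLE
  have hdet' : ∀ t, 0 < t → total t (C t * (plant t)^[p] (legsVal t L)) ≤ total t (C t * T.val t) :=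
    fun t ht => ((hdet t ht).mul_left (hC t ht)).2
  rcases Nat.eq_zero_or_pos T.leaves with h0 | h0
  · have h1 := GraftTree.order_eq_one_of_leaves h0
    have hL0 : L = 0 := by rw [← Multiset.card_eq_zero, hL, h0]
    obtain rfl : p = 0 := by omega
    refine ⟨0, 0, by omega, by omega, by omega, Nat.zero_le _, fun t ht => ?_⟩
    rw [h0]
    rw [hL0] at hdet'
    exact hdet' t ht
  · have hL0 : L ≠ 0 := by rw [← Multiset.card_pos, hL]; exact h0
    obtain ⟨i, M, hM, hMsum, hi, hMdet⟩ := exists_total_le hC hj p hL0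
    rw [hL] at hM hi
    have hle := T.leaves_add_one_le_order
    -- There must be enough vertices for all legs to be nonempty. If i > 0, the bound on i, which is
    -- then not truncated, leaves at least (i + j) times the number of leaves.
    have hs : T.leaves ≤ M.sum := by
      rcases Nat.eq_zero_or_pos i with h | h
      · omega
      · rw [Nat.le_div_iff_mul_le (by omega)] at hi
        have h1 : T.leaves + 1 ≤ i * (T.leaves + 1) := Nat.le_mul_of_pos_left _ h
        have h2 : T.leaves ≤ j * T.leaves := Nat.le_mul_of_pos_left _ hj0
        have h3 : i ≤ i * (T.leaves + 1) := Nat.le_mul_of_pos_right _ (by omega)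
        omega
    refine ⟨i, M.sum, by omega, hs, by omega, ?_, fun t ht => ?_⟩
    · rwa [show T.order - 1 = p + L.sum by omega]
    · refine le_trans ?_ ((hMdet t ht).trans (hdet' t ht))
      have hb : DetLE t (legsVal t (balancedLegs T.leaves M.sum)) (legsVal t M) :=
        detLE_legsVal_of_balanced ht
          (by rw [← Multiset.card_pos, card_balancedLegs]; exact h0)
          (balancedLegs_le_add_one hs) _ rfl (by rw [hM, card_balancedLegs])
          (by rw [sum_balancedLegs h0 hs])
      rw [← total_iterate_plant_mul ht, ← total_iterate_plant_mul ht]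
      exact (hb.mul_left ((hC t ht).iterate_plant ht i)).2

open Classical in
/-- The common part of the two cases: `C t` is the loaded rooted graph of the cycle. -/
theorem exists_LEL_balancedUnicyclic_le {m j : ℕ} {C : ℝ → DualNumber ℝ} (hj0 : 1 ≤ j)
    (hC : ∀ t, 0 < t → IsLoaded (C t)) (hj : ∀ t, 0 < t → LoadLE (pathVal t j) (C t))
    (hcycle : ∀ t, 0 < t → ∀ x : Fin (m + 3) → DualNumber ℝ, (∀ i, IsLoaded (x i)) →
      total t (C t * ∏ i, x i) ≤ lapDet t (SimpleGraph.cycleGraph (m + 3)) x)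
    (hparent : ∀ l p t x, lapDet t (parentGraph (m + 3) (starlikeParent (m + 3) l p) (m + 3))
      (fun i => if (i : ℕ) = 0 then x else 1) = total t (C t * x))
    {V : Type*} [Fintype V] {G : SimpleGraph V} (hG : IsUnicyclic G) (hgirth : G.girth = m + 3) :
    ∃ i ≤ (Fintype.card V - (m + 3) - j * numLeaves G) / (numLeaves G + 1),
      LEL (balancedUnicyclic (Fintype.card V) (numLeaves G) (m + 3) i) ≤ LEL G := by
  obtain ⟨hconn, hedges⟩ := hG
  have hcyclic : ¬ G.IsAcyclic := by
    rw [← SimpleGraph.girth_eq_zero]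
    omega
  obtain ⟨a, w, hw, hlen⟩ := SimpleGraph.exists_girth_eq_length.2 hcyclic
  obtain ⟨φ, hφ⟩ := hw.exists_cycleGraph_hom (hlen.symm.trans hgirth)
  have hsum : ∑ v, G.degree v = 2 * Fintype.card V := by
    rw [G.sum_degrees_eq_twice_card_edges, ← hedges, Set.ncard_eq_toFinset_card']
    rfl
  obtain ⟨T', hdet, hord, hlv⟩ := SimpleGraph.Connected.exists_graftTree_decoration _
    (fun _ : V => GraftTree.single) rfl hconn hsum φ hφ
  -- All trees of the cycle are glued at one vertex; `hcycle` says that this does not raise the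
  -- determinant.
  obtain ⟨T, hT, hTord, hTlv⟩ := GraftTree.exists_val_eq_prod Finset.univ T'
  have hleaves : T.leaves = numLeaves G := by
    rw [hTlv, hlv, numLeaves, Finset.card_filter]
    rfl
  have horder : T.order + (m + 3) = Fintype.card V + 1 := by
    rw [hord] at hTord
    simpa [GraftTree.order] using hTord
  obtain ⟨i, s, his, hls, hl0, hi, hle⟩ := exists_total_balancedLegs_le hj0 hC hj T
  rw [hleaves] at hls hl0 hi hle
  have hn : Fintype.card V = m + 3 + i + s := by omega
  refine ⟨i, ?_, LEL_le_LEL_of_lapDet_le (by simp) fun t ht => ?_⟩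
  · rwa [show Fintype.card V - (m + 3) = T.order - 1 by omega]
  · rw [hn, lapDet_balancedUnicyclic_parentGraph (by omega) hls hl0 t ht, hparent]
    refine (hle t ht).trans ?_
    rw [hT]
    refine (hcycle t ht _ fun i => (T' i).val_pos ht).trans ?_
    rw [← hdet t ht]
    rfl

/-! ### Explicit determinants for cycles of length three and four. -/

theorem loadedLap_cycleGraph (t : ℝ) {m : ℕ} (x : Fin (m + 3) → DualNumber ℝ) (i j : Fin (m + 3)) :
    loadedLap t (SimpleGraph.cycleGraph (m + 3)) x i j =
      if i = j then (x i).snd + (t + 2) * (x i).fst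
      else if i - j = 1 ∨ j - i = 1 then -(x i).fst else 0 := by
  classical
  have hdeg : ∀ [Fintype ((SimpleGraph.cycleGraph (m + 3)).neighborSet i)],
      (SimpleGraph.cycleGraph (m + 3)).degree i = 2 := by
    intro _
    convert SimpleGraph.cycleGraph_degree_three_le (v := i)
  simp only [loadedLap, hdeg, SimpleGraph.cycleGraph_adj]
  split_ifs
  · push_cast
    ring
  · rfl
  · rfl

theorem lapDet_eq_det {V : Type*} [Fintype V] [DecidableEq V] (t : ℝ) (G : SimpleGraph V)
    (x : V → DualNumber ℝ) : lapDet t G x = (loadedLap t G x).det := by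
  unfold lapDet
  congr!

theorem lapDet_cycleGraph_three (t : ℝ) (x : Fin 3 → DualNumber ℝ) :
    lapDet t (SimpleGraph.cycleGraph 3) x =
      ((x 0).snd + (t + 2) * (x 0).fst) * ((x 1).snd + (t + 2) * (x 1).fst) *
        ((x 2).snd + (t + 2) * (x 2).fst) - 2 * (x 0).fst * (x 1).fst * (x 2).fst
      - ((x 0).snd + (t + 2) * (x 0).fst) * (x 1).fst * (x 2).fst
      - ((x 1).snd + (t + 2) * (x 1).fst) * (x 0).fst * (x 2).fst
      - ((x 2).snd + (t + 2) * (x 2).fst) * (x 0).fst * (x 1).fst := by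
  rw [lapDet_eq_det, Matrix.det_fin_three]
  simp only [loadedLap_cycleGraph (m := 0)]
  simp +decide
  ring

theorem lapDet_cycleGraph_four (t : ℝ) (x : Fin 4 → DualNumber ℝ) :
    lapDet t (SimpleGraph.cycleGraph 4) x =
      ((x 0).snd + (t + 2) * (x 0).fst) * ((x 1).snd + (t + 2) * (x 1).fst) *
        ((x 2).snd + (t + 2) * (x 2).fst) * ((x 3).snd + (t + 2) * (x 3).fst)
      - ((x 0).snd + (t + 2) * (x 0).fst) * ((x 1).snd + (t + 2) * (x 1).fst) *
        (x 2).fst * (x 3).fst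
      - ((x 1).snd + (t + 2) * (x 1).fst) * ((x 2).snd + (t + 2) * (x 2).fst) *
        (x 3).fst * (x 0).fst
      - ((x 2).snd + (t + 2) * (x 2).fst) * ((x 3).snd + (t + 2) * (x 3).fst) *
        (x 0).fst * (x 1).fst
      - ((x 3).snd + (t + 2) * (x 3).fst) * ((x 0).snd + (t + 2) * (x 0).fst) *
        (x 1).fst * (x 2).fst := by
  rw [lapDet_eq_det, Matrix.det_succ_row_zero, Fin.sum_univ_four]
  simp only [Matrix.det_fin_three, Matrix.submatrix_apply, loadedLap_cycleGraph (m := 1)]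
  simp +decide
  ring

/-- As polynomials in the loads at the cycle vertices both sides have the same constant and linear
parts, by symmetry of the cycle. The right side has further terms of higher degree, with nonnegative
coefficients. The same holds for the quadrilateral. -/
theorem total_triangleVal_le {t : ℝ} (ht : 0 < t) (x : Fin 3 → DualNumber ℝ)
    (hx : ∀ i, IsLoaded (x i)) :
    total t (triangleVal t * ∏ i, x i) ≤ lapDet t (SimpleGraph.cycleGraph 3) x := by
  obtain ⟨h0, h0'⟩ := hx 0
  obtain ⟨h1, h1'⟩ := hx 1
  obtain ⟨h2, h2'⟩ := hx 2
  rw [lapDet_cycleGraph_three, Fin.prod_univ_three]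
  simp only [total, fst_triangleVal, snd_triangleVal, TrivSqZeroExt.fst_mul, dual_snd_mul]
  rw [← sub_nonneg]
  ring_nf
  positivity

theorem total_squareVal_le {t : ℝ} (ht : 0 < t) (x : Fin 4 → DualNumber ℝ)
    (hx : ∀ i, IsLoaded (x i)) :
    total t (squareVal t * ∏ i, x i) ≤ lapDet t (SimpleGraph.cycleGraph 4) x := by
  obtain ⟨h0, h0'⟩ := hx 0
  obtain ⟨h1, h1'⟩ := hx 1
  obtain ⟨h2, h2'⟩ := hx 2
  obtain ⟨h3, h3'⟩ := hx 3
  rw [lapDet_cycleGraph_four, Fin.prod_univ_four]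
  simp only [total, fst_squareVal, snd_squareVal, TrivSqZeroExt.fst_mul, dual_snd_mul]
  rw [← sub_nonneg]
  ring_nf
  positivity

theorem parentGraph_three (l p : ℕ) :
    parentGraph 3 (starlikeParent 3 l p) 3 = SimpleGraph.cycleGraph 3 := by
  ext i j
  fin_cases i <;> fin_cases j <;>
    simp +decide [parentGraph, starlikeParent]

theorem parentGraph_four (l p : ℕ) :
    parentGraph 4 (starlikeParent 4 l p) 4 = SimpleGraph.cycleGraph 4 := by
  ext i j
  fin_cases i <;> fin_cases j <;>
    simp +decide [parentGraph, starlikeParent]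

theorem lapDet_parentGraph_three (l p : ℕ) (t : ℝ) (x : DualNumber ℝ) :
    lapDet t (parentGraph 3 (starlikeParent 3 l p) 3) (fun i => if (i : ℕ) = 0 then x else 1) =
      total t (triangleVal t * x) := by
  rw [parentGraph_three, lapDet_cycleGraph_three]
  simp [total]
  ring

theorem lapDet_parentGraph_four (l p : ℕ) (t : ℝ) (x : DualNumber ℝ) :
    lapDet t (parentGraph 4 (starlikeParent 4 l p) 4) (fun i => if (i : ℕ) = 0 then x else 1) =
      total t (squareVal t * x) := by
  rw [parentGraph_four, lapDet_cycleGraph_four]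
  simp [total]
  ring

/-- For a unicyclic graph `G` with `n` vertices and `l` leaves of girth `3` (respectively `4`),
`LEL G` is at least the minimum of the numbers `LEL (U_{n,l}^{g,i})`, `0 ≤ i ≤ max (0, p)`, where
`p` is the floor of `(n - 3 - 2 l) / (l + 1)` (respectively of `(n - 4 - 3 l) / (l + 1)`).
The subtraction and division of natural numbers below compute exactly `max (0, p)`. -/
theorem corollary4p7 {V : Type*} [Fintype V] (G : SimpleGraph V) (n l : ℕ)
    (hn : Fintype.card V = n) (hG : IsUnicyclic G) (hl : numLeaves G = l) :
    (G.girth = 3 →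
      (Finset.range ((n - 3 - 2 * l) / (l + 1) + 1)).inf' Finset.nonempty_range_add_one
        (fun i => LEL (balancedUnicyclic n l 3 i)) ≤ LEL G) ∧
    (G.girth = 4 →
      (Finset.range ((n - 4 - 3 * l) / (l + 1) + 1)).inf' Finset.nonempty_range_add_one
        (fun i => LEL (balancedUnicyclic n l 4 i)) ≤ LEL G) := by
  subst hn hl
  constructor
  · intro hg
    obtain ⟨i, hi, hle⟩ := exists_LEL_balancedUnicyclic_le (m := 0) (j := 2) (by norm_num)
      (fun t => isLoaded_triangleVal) (fun t => loadLE_triangleVal)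
      (fun t => total_triangleVal_le) lapDet_parentGraph_three hG hg
    exact (Finset.inf'_le _ (Finset.mem_range.2 (Nat.lt_succ_of_le hi))).trans hle
  · intro hg
    obtain ⟨i, hi, hle⟩ := exists_LEL_balancedUnicyclic_le (m := 1) (j := 3) (by norm_num)
      (fun t => isLoaded_squareVal) (fun t => loadLE_squareVal)
      (fun t => total_squareVal_le) lapDet_parentGraph_four hG hg
    exact (Finset.inf'_le _ (Finset.mem_range.2 (Nat.lt_succ_of_le hi))).trans hle
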